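/- A graph function is a Borel measurable function $g:[0,1]^2\to[0,1]$ with $g(x,y)=g(y,x)$ for almost every $(x,y)$. For a bounded measurable $w$ on $[0,1]^2$ let $\|w\|_{\square}=\sup_{S,T}\left|\int_{S\times T}w\right|$, the supremum being over measurable $S,T\subset[0,1]$. Two graph functions $g_1,g_2$ are equivalent if $\inf_\sigma\|g_1^\sigma-g_2\|_\square=0$, where $g^\sigma(x,y)=g(\sigma(x),\sigma(y))$ and $\sigma$ runs over the Lebesgue-measure-preserving measurable bijections of $[0,1]$; a graphon $\gamma=[g]$ is an equivalence class of graph functions. Its edge density is $\iint_{[0,1]^2} g(x,y)\,dx\,dy$ (independent of the representative $g$), and for $p\in[0,1]$, $\gamma_p$ denotes the class of the constant function $p$. For a graph function $g$ let $T_g$ be the operator on $L^2([0,1])$ defined by $(T_gf)(x)=\int_0^1 g(x,y)f(y)\,dy$, let $(\lambda_i)_{i\in I}$ be its nonzero eigenvalues, repeated according to multiplicity, and set $$\mathrm{det}_3(\mathrm{id}+zT_g)=\prod_{i\in I}(1+z\lambda_i)\,e^{-z\lambda_i+z^2\lambda_i^2/2},\qquad z\in\mathbb{C}.$$ **Proposition.**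 Let $\gamma$ be a graphon, $g$ any graph function representing $\gamma$, and $p\in[0,1]$. The product defining $\mathrm{det}_3(\gamma,z)=\mathrm{det}_3(\mathrm{id}+zT_g)$ converges unconditionally for every $z\in\mathbb{C}$, and the following are equivalent: 1. $\gamma=\gamma_p$; 2. $\gamma$ has edge density $p$, and $\mathrm{det}_3(\gamma,z)=(1+pz)\,e^{-pz+p^2z^2/2}$ for all $z\in\mathbb{C}$. -/

import Mathlib

open MeasureTheory
open scoped ENNReal

noncomputable section

/-- A graph function: a Borel function on the unit square with values in `[0,1]`, symmetric almost
everywhere for the Lebesgue measure. Functions that agree almost everywhere are identified later,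
in the quotient `Graphon`. -/
structure GraphFunction where
  toFun : unitInterval × unitInterval → ℝ
  measurable' : Measurable toFun
  mem_Icc' : ∀ z, toFun z ∈ Set.Icc (0 : ℝ) 1
  symm' : ∀ᵐ z : unitInterval × unitInterval, toFun (z.1, z.2) = toFun (z.2, z.1)

/-- The cut norm of a (bounded measurable) function on the unit square. -/
def cutNorm (w : unitInterval × unitInterval → ℝ) : ℝ :=
  ⨆ P : {S : Set unitInterval // MeasurableSet S} × {T : Set unitInterval // MeasurableSet T},
    |∫ z in (P.1 : Set unitInterval) ×ˢ (P.2 : Set unitInterval), w z|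

/-- Lebesgue isomorphisms of `[0,1]`: measurable bijections preserving the Lebesgue measure
(the inverse of a Borel bijection of `[0,1]` is automatically Borel). -/
def LebesgueIso : Type := {σ : unitInterval ≃ᵐ unitInterval // MeasurePreserving σ volume volume}

namespace LebesgueIso

def id : LebesgueIso := ⟨MeasurableEquiv.refl unitInterval, MeasurePreserving.id _⟩

def inv (σ : LebesgueIso) : LebesgueIso := ⟨σ.1.symm, σ.2.symm σ.1⟩

def comp (σ τ : LebesgueIso) : LebesgueIso := ⟨τ.1.trans σ.1, σ.2.comp τ.2⟩

instance : Nonempty LebesgueIso := ⟨id⟩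

/-- The action of a Lebesgue isomorphism on the unit square. -/
def square (σ : LebesgueIso) : unitInterval × unitInterval ≃ᵐ unitInterval × unitInterval := σ.1.prodCongr σ.1

theorem square_apply (σ : LebesgueIso) (z : unitInterval × unitInterval) : σ.square z = (σ.1 z.1, σ.1 z.2) := rfl

theorem measurePreserving_square (σ : LebesgueIso) :
    MeasurePreserving σ.square volume volume :=
  σ.2.prod σ.2

end LebesgueIso

/-- The right action `w ↦ w^σ`, `w^σ(x,y) = w(σ x, σ y)`. -/
def relabel (σ : LebesgueIso) (w : unitInterval × unitInterval → ℝ) : unitInterval × unitInterval → ℝ :=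
  fun z => w (σ.1 z.1, σ.1 z.2)

theorem cutNorm_nonneg (w : unitInterval × unitInterval → ℝ) : 0 ≤ cutNorm w :=
  Real.iSup_nonneg fun _ => abs_nonneg _

theorem cutNorm_bddAbove {w : unitInterval × unitInterval → ℝ} (hw : Integrable w) :
    BddAbove (Set.range fun P : {S : Set unitInterval // MeasurableSet S} × {T : Set unitInterval // MeasurableSet T} =>
      |∫ z in (P.1 : Set unitInterval) ×ˢ (P.2 : Set unitInterval), w z|) := by
  refine ⟨∫ z, |w z|, ?_⟩
  rintro _ ⟨P, rfl⟩
  refine (abs_integral_le_integral_abs).trans ?_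
  exact setIntegral_le_integral hw.abs (Filter.Eventually.of_forall fun _ => abs_nonneg _)

theorem le_cutNorm {w : unitInterval × unitInterval → ℝ} (hw : Integrable w) {S T : Set unitInterval}
    (hS : MeasurableSet S) (hT : MeasurableSet T) :
    |∫ z in S ×ˢ T, w z| ≤ cutNorm w :=
  le_ciSup (cutNorm_bddAbove hw) (⟨S, hS⟩, ⟨T, hT⟩)

theorem cutNorm_sub_comm (u v : unitInterval × unitInterval → ℝ) :
    cutNorm (fun z => u z - v z) = cutNorm (fun z => v z - u z) := by
  unfold cutNorm
  congr 1
  funext P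
  rw [← abs_neg, ← integral_neg]
  simp

theorem cutNorm_sub_le {u v w : unitInterval × unitInterval → ℝ} (hu : Integrable u) (hv : Integrable v)
    (hw : Integrable w) :
    cutNorm (fun z => u z - w z) ≤
      cutNorm (fun z => u z - v z) + cutNorm (fun z => v z - w z) := by
  have : Nonempty ({S : Set unitInterval // MeasurableSet S} × {T : Set unitInterval // MeasurableSet T}) :=
    ⟨(⟨∅, .empty⟩, ⟨∅, .empty⟩)⟩
  refine ciSup_le fun P => ?_
  have e : ∫ z in (P.1 : Set unitInterval) ×ˢ (P.2 : Set unitInterval), (u z - w z) =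
      (∫ z in (P.1 : Set unitInterval) ×ˢ (P.2 : Set unitInterval), (u z - v z)) +
        ∫ z in (P.1 : Set unitInterval) ×ˢ (P.2 : Set unitInterval), (v z - w z) := by
    have ha := integral_add (hu.sub hv).integrableOn (hv.sub hw).integrableOn
      (μ := volume.restrict ((P.1 : Set unitInterval) ×ˢ (P.2 : Set unitInterval)))
    simp only [Pi.sub_apply] at ha
    rw [← ha]
    simp
  rw [e]
  exact (abs_add_le _ _).trans
    (add_le_add (le_cutNorm (hu.sub hv) P.1.2 P.2.2) (le_cutNorm (hv.sub hw) P.1.2 P.2.2))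

theorem integrable_relabel (σ : LebesgueIso) {w : unitInterval × unitInterval → ℝ} (hw : Integrable w) :
    Integrable (relabel σ w) :=
  (σ.measurePreserving_square.integrable_comp_emb σ.square.measurableEmbedding).2 hw

theorem cutNorm_relabel_le (σ : LebesgueIso) {w : unitInterval × unitInterval → ℝ} (hw : Integrable w) :
    cutNorm (relabel σ w) ≤ cutNorm w := by
  have : Nonempty ({S : Set unitInterval // MeasurableSet S} × {T : Set unitInterval // MeasurableSet T}) :=
    ⟨(⟨∅, .empty⟩, ⟨∅, .empty⟩)⟩
  refine ciSup_le fun P => ?_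
  have h := σ.measurePreserving_square.setIntegral_preimage_emb
    σ.square.measurableEmbedding w
    ((σ.1.symm ⁻¹' (P.1 : Set unitInterval)) ×ˢ (σ.1.symm ⁻¹' (P.2 : Set unitInterval)))
  have hpre : σ.square ⁻¹' ((σ.1.symm ⁻¹' (P.1 : Set unitInterval)) ×ˢ (σ.1.symm ⁻¹' (P.2 : Set unitInterval))) =
      (P.1 : Set unitInterval) ×ˢ (P.2 : Set unitInterval) := by
    ext z
    simp [LebesgueIso.square_apply]
  rw [hpre] at h
  have h' : ∫ z in (P.1 : Set unitInterval) ×ˢ (P.2 : Set unitInterval), relabel σ w z =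
      ∫ z in (P.1 : Set unitInterval) ×ˢ (P.2 : Set unitInterval), w (σ.square z) := rfl
  rw [h', h]
  exact le_cutNorm hw (σ.1.symm.measurable P.1.2) (σ.1.symm.measurable P.2.2)

namespace GraphFunction

theorem integrable (g : GraphFunction) : Integrable g.toFun :=
  Integrable.of_bound g.measurable'.aestronglyMeasurable 1
    (Filter.Eventually.of_forall fun z => by
      rw [Real.norm_eq_abs, abs_of_nonneg (g.mem_Icc' z).1]
      exact (g.mem_Icc' z).2)

/-- The cut metric `δ(g₁,g₂) = inf_σ ‖g₁^σ - g₂‖`. -/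
def cutDist (g₁ g₂ : GraphFunction) : ℝ :=
  ⨅ σ : LebesgueIso, cutNorm (fun z => relabel σ g₁.toFun z - g₂.toFun z)

theorem cutDist_nonneg (g₁ g₂ : GraphFunction) : 0 ≤ cutDist g₁ g₂ :=
  le_ciInf fun _ => cutNorm_nonneg _

theorem cutDist_le (g₁ g₂ : GraphFunction) (σ : LebesgueIso) :
    cutDist g₁ g₂ ≤ cutNorm (fun z => relabel σ g₁.toFun z - g₂.toFun z) :=
  ciInf_le ⟨0, by rintro _ ⟨τ, rfl⟩; exact cutNorm_nonneg _⟩ σ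

theorem cutDist_self (g : GraphFunction) : cutDist g g = 0 := by
  refine le_antisymm ((cutDist_le g g LebesgueIso.id).trans ?_) (cutDist_nonneg g g)
  simp [relabel, LebesgueIso.id, cutNorm]

theorem cutDist_comm_le (g₁ g₂ : GraphFunction) : cutDist g₂ g₁ ≤ cutDist g₁ g₂ := by
  refine le_ciInf fun σ => (cutDist_le g₂ g₁ σ.inv).trans ?_
  rw [cutNorm_sub_comm]
  have h := cutNorm_relabel_le σ.inv ((integrable_relabel σ g₁.integrable).sub g₂.integrable)
  refine le_trans (le_of_eq ?_) h
  congr 1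
  funext z
  simp [relabel, LebesgueIso.inv]

theorem cutDist_triangle (g₁ g₂ g₃ : GraphFunction) :
    cutDist g₁ g₃ ≤ cutDist g₁ g₂ + cutDist g₂ g₃ := by
  refine le_ciInf_add_ciInf fun σ τ => (cutDist_le g₁ g₃ (σ.comp τ)).trans ?_
  have h := cutNorm_relabel_le τ ((integrable_relabel σ g₁.integrable).sub g₂.integrable)
  have h3 := cutNorm_sub_le (integrable_relabel (σ.comp τ) g₁.integrable)
    (integrable_relabel τ g₂.integrable) g₃.integrable
  exact h3.trans (add_le_add_left h _)

/-- Two graph functions are equivalent when their cut distance vanishes. -/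
instance setoid : Setoid GraphFunction where
  r g₁ g₂ := cutDist g₁ g₂ = 0
  iseqv :=
    { refl := cutDist_self
      symm := fun {g₁ g₂} h =>
        le_antisymm ((cutDist_comm_le g₁ g₂).trans h.le) (cutDist_nonneg _ _)
      trans := fun {g₁ g₂ g₃} h h' =>
        le_antisymm ((cutDist_triangle g₁ g₂ g₃).trans (by rw [h, h', add_zero]))
          (cutDist_nonneg _ _) }

/-- The constant graph function `g(x,y) = p`. -/
def const (p : ℝ) (hp : p ∈ Set.Icc (0 : ℝ) 1) : GraphFunction where
  toFun := fun _ => p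
  measurable' := measurable_const
  mem_Icc' := fun _ => hp
  symm' := Filter.Eventually.of_forall fun _ => rfl

/-- The density of the graph with two vertices and one edge: `∫∫ g(x,y) dx dy`. -/
def edgeDensity (g : GraphFunction) : ℝ := ∫ z : unitInterval × unitInterval, g.toFun z

theorem abs_edgeDensity_sub_le (g₁ g₂ : GraphFunction) :
    |edgeDensity g₁ - edgeDensity g₂| ≤ cutDist g₁ g₂ := by
  refine le_ciInf fun σ => ?_
  have h := le_cutNorm ((integrable_relabel σ g₁.integrable).sub g₂.integrable)
    MeasurableSet.univ MeasurableSet.univ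
  refine le_trans (le_of_eq ?_) h
  have hσ : ∫ z, relabel σ g₁.toFun z = ∫ z, g₁.toFun z :=
    σ.measurePreserving_square.integral_comp σ.square.measurableEmbedding g₁.toFun
  have hsub := integral_sub (integrable_relabel σ g₁.integrable) g₂.integrable
  simp only [Set.univ_prod_univ, Measure.restrict_univ, Pi.sub_apply]
  rw [hsub, hσ]
  rfl

/-! The integral operator on the real Hilbert space `L²([0,1])`. -/

/-- `x ↦ ∫ g(x,y) f(y) dy`. -/
def kernelIntegral (g : GraphFunction) (f : unitInterval → ℝ) (x : unitInterval) : ℝ := ∫ y, g.toFun (x, y) * f y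

theorem integrable_slice (g : GraphFunction) {f : unitInterval → ℝ} (hf : Integrable f) (x : unitInterval) :
    Integrable (fun y => g.toFun (x, y) * f y) :=
  hf.bdd_mul (c := 1)
    (g.measurable'.comp measurable_prodMk_left).aestronglyMeasurable
    (Filter.Eventually.of_forall fun y => by
      rw [Real.norm_eq_abs, abs_of_nonneg (g.mem_Icc' _).1]
      exact (g.mem_Icc' _).2)

theorem integrable_of_Lp (f : Lp ℝ 2 (volume : Measure unitInterval)) : Integrable f :=
  (Lp.memLp f).integrable (by norm_num)

theorem norm_kernelIntegral_le (g : GraphFunction) (f : Lp ℝ 2 (volume : Measure unitInterval)) (x : unitInterval) :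
    ‖kernelIntegral g f x‖ ≤ ‖f‖ := by
  have hf := integrable_of_Lp f
  have h1 : ‖kernelIntegral g f x‖ ≤ ∫ y, ‖f y‖ := by
    refine norm_integral_le_of_norm_le hf.norm (Filter.Eventually.of_forall fun y => ?_)
    rw [norm_mul, Real.norm_eq_abs, abs_of_nonneg (g.mem_Icc' _).1]
    exact mul_le_of_le_one_left (norm_nonneg _) (g.mem_Icc' _).2
  refine h1.trans ?_
  rw [integral_norm_eq_lintegral_enorm hf.aestronglyMeasurable, Lp.norm_def,
    ← eLpNorm_one_eq_lintegral_enorm]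
  exact ENNReal.toReal_mono (Lp.eLpNorm_ne_top f)
    (eLpNorm_le_eLpNorm_of_exponent_le (by norm_num) hf.aestronglyMeasurable)

theorem memLp_kernelIntegral (g : GraphFunction) (f : Lp ℝ 2 (volume : Measure unitInterval)) :
    MemLp (kernelIntegral g f) 2 volume := by
  refine MemLp.of_bound ?_ ‖f‖ (Filter.Eventually.of_forall (norm_kernelIntegral_le g f))
  have hm : StronglyMeasurable fun z : unitInterval × unitInterval => g.toFun z * f z.2 :=
    g.measurable'.stronglyMeasurable.mul ((Lp.stronglyMeasurable f).comp_measurable measurable_snd)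
  exact hm.integral_prod_right'.aestronglyMeasurable

/-- The integral operator `T_g f (x) = ∫ g(x,y) f(y) dy` on `L²([0,1])`. -/
def integralOperator (g : GraphFunction) :
    Lp ℝ 2 (volume : Measure unitInterval) →L[ℝ] Lp ℝ 2 (volume : Measure unitInterval) :=
  LinearMap.mkContinuous
    { toFun := fun f => (memLp_kernelIntegral g f).toLp (kernelIntegral g f)
      map_add' := fun f₁ f₂ => by
        rw [← MemLp.toLp_add]
        refine MemLp.toLp_congr _ _ (Filter.Eventually.of_forall fun x => ?_)
        simp only [kernelIntegral, Pi.add_apply]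
        rw [← integral_add (integrable_slice g (integrable_of_Lp f₁) x)
          (integrable_slice g (integrable_of_Lp f₂) x)]
        refine integral_congr_ae ?_
        filter_upwards [Lp.coeFn_add f₁ f₂] with y hy
        rw [hy, Pi.add_apply, mul_add]
      map_smul' := fun c f => by
        rw [RingHom.id_apply, ← MemLp.toLp_const_smul]
        refine MemLp.toLp_congr _ _ (Filter.Eventually.of_forall fun x => ?_)
        simp only [kernelIntegral, Pi.smul_apply, smul_eq_mul]
        rw [← integral_const_mul]
        refine integral_congr_ae ?_
        filter_upwards [Lp.coeFn_smul c f] with y hy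
        rw [hy, Pi.smul_apply, smul_eq_mul]
        ring }
    1 (fun f => by
      rw [one_mul]
      refine Lp.norm_le_of_ae_bound (norm_nonneg f) ?_ |>.trans ?_
      · filter_upwards [(memLp_kernelIntegral g f).coeFn_toLp] with x hx
        exact hx ▸ norm_kernelIntegral_le g f x
      · simp [measureUnivNNReal])

/-- The multiplicity of the real number `l` as an eigenvalue of `T_g`, i.e. the dimension of
`ker (T_g - l)`; it is `0` when `l` is not an eigenvalue, and it is finite for `l ≠ 0`, because
`T_g` is a Hilbert-Schmidt operator. -/
def multiplicity (g : GraphFunction) (l : ℝ) : ℕ :=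
  Module.finrank ℝ (Module.End.eigenspace (integralOperator g).toLinearMap l)

/-- The factor `(1 + z l) exp (-z l + z² l² / 2)`, repeated according to multiplicity. It is equal
to `1` if `l = 0` and if `l` is not an eigenvalue of `T_g`. -/
def detFactor (g : GraphFunction) (z : ℂ) (l : ℝ) : ℂ :=
  ((1 + z * l) * Complex.exp (-(z * l) + z ^ 2 * (l : ℂ) ^ 2 / 2)) ^ multiplicity g l

/-- The `3`-modified Fredholm determinant `det₃(id + z T_g)`: the product, over the nonzero
eigenvalues `l` of `T_g` counted with multiplicity, of `(1 + z l) exp (-z l + z² l² / 2)`. -/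
def det₃ (g : GraphFunction) (z : ℂ) : ℂ := ∏' l : ℝ, detFactor g z l

end GraphFunction

/-- A graphon is a class of graph functions at cut distance zero. -/
def Graphon : Type := Quotient GraphFunction.setoid

namespace Graphon

/-- The class `[g]` of a graph function. -/
def mk (g : GraphFunction) : Graphon := Quotient.mk _ g

/-- The constant graphon `γ_p`. -/
def const (p : ℝ) (hp : p ∈ Set.Icc (0 : ℝ) 1) : Graphon := mk (GraphFunction.const p hp)

/-- The edge density of a graphon, i.e. that of any of its representatives. -/
def edgeDensity (γ : Graphon) : ℝ :=
  Quotient.lift GraphFunction.edgeDensity (fun g₁ g₂ (h : GraphFunction.cutDist g₁ g₂ = 0) =>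
    sub_eq_zero.1 (abs_nonpos_iff.1
      ((GraphFunction.abs_edgeDensity_sub_le g₁ g₂).trans h.le))) γ

end Graphon

end

/-!
The class of `g` is `γ_p` iff `g = p` almost everywhere: relabelling does not move a constant, and
an integrable function whose integrals over rectangles vanish is zero. Equivalently, `T_g` is `p`
times the projection onto the constants. Since the slices of `g` are bounded, `T_g` is
Hilbert–Schmidt, hence compact, and the squares of its eigenvalues are summable; as the factors of
`det₃` are `1 + O(w²)`, the product converges. The zeros of `det₃` are the points `-1/l`, so the
given determinant leaves only the eigenvalue `p`, and its value at `1/p` makes `p` simple. By the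
spectral theorem `T_g` is then `p` times a projection `P` of rank one, and the edge density
`⟨1, T_g 1⟩ = p ‖P 1‖²` equals `p` only if `P` fixes the constants.
-/

section HilbertSchmidt

variable {𝕜 E F : Type*} [RCLike 𝕜] [NormedAddCommGroup E] [InnerProductSpace 𝕜 E]

theorem exists_orthonormal_fin_finrank : ∃ b : Fin (Module.finrank 𝕜 E) → E, Orthonormal 𝕜 b := by
  by_cases h : FiniteDimensional 𝕜 E
  · exact ⟨stdOrthonormalBasis 𝕜 E, (stdOrthonormalBasis 𝕜 E).orthonormal⟩
  · rw [Module.finrank_of_not_finite h]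
    exact ⟨Fin.elim0, .of_isEmpty _⟩

section NormedSpace

variable [NormedAddCommGroup F] [NormedSpace 𝕜 F] {T : E →L[𝕜] F}

theorem isCompactOperator_of_forall_exists_norm_le_on_orthogonal [CompleteSpace F]
    (h : ∀ ε > 0, ∃ K : Submodule 𝕜 E, FiniteDimensional 𝕜 K ∧ ∀ x ∈ Kᗮ, ‖T x‖ ≤ ε * ‖x‖) :
    IsCompactOperator T := by
  refine isClosed_setOfPred_isCompactOperator.closure_subset
    (Metric.mem_closure_iff.2 fun ε hε => ?_)
  obtain ⟨K, hfin, hK⟩ := h (ε / 2) (half_pos hε)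
  have : ProperSpace K := FiniteDimensional.proper_rclike 𝕜 K
  refine ⟨T.comp K.starProjection, ?_, ?_⟩
  · exact (isCompactOperator_of_locallyCompactSpace_rng (T.comp K.subtypeL)).comp_clm
      K.orthogonalProjectionOnto
  rw [dist_eq_norm]
  refine (ContinuousLinearMap.opNorm_le_bound _ (half_pos hε).le fun x => ?_).trans_lt
    (half_lt_self hε)
  calc ‖(T - T.comp K.starProjection) x‖
      = ‖T (Kᗮ.starProjection x)‖ := by simp [K.starProjection_orthogonal_val]
    _ ≤ ε / 2 * ‖Kᗮ.starProjection x‖ := hK _ (Kᗮ.starProjection_apply_mem x)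
    _ ≤ ε / 2 * ‖x‖ := by gcongr; exact Kᗮ.norm_starProjection_apply_le x

/-- Hilbert–Schmidt operators: the sums `∑ ‖T eᵢ‖²` over finite orthonormal families are bounded
(their supremum is then the square of the Hilbert–Schmidt norm). Stated in this way, the notion
needs neither a Hilbert basis nor completeness. -/
def IsHilbertSchmidt (T : E →L[𝕜] F) : Prop :=
  BddAbove {r : ℝ | ∃ (n : ℕ) (e : Fin n → E), Orthonormal 𝕜 e ∧ ∑ i, ‖T (e i)‖ ^ 2 = r}

namespace IsHilbertSchmidt

theorem summable_norm_sq (h : IsHilbertSchmidt T) {ι : Type*} {e : ι → E} (he : Orthonormal 𝕜 e) :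
    Summable fun i => ‖T (e i)‖ ^ 2 := by
  obtain ⟨C, hC⟩ := h
  refine summable_of_sum_le (c := C) (fun _ => sq_nonneg _) fun s => ?_
  rw [← s.sum_coe_sort, ← s.equivFin.symm.sum_comp]
  exact hC ⟨_, _, he.comp _ (Subtype.val_injective.comp s.equivFin.symm.injective), rfl⟩

-- A finite orthonormal family that nearly attains the supremum leaves little room for any further
-- unit vector orthogonal to it.
theorem exists_norm_le_on_orthogonal (h : IsHilbertSchmidt T) {ε : ℝ} (hε : 0 < ε) :
    ∃ K : Submodule 𝕜 E, FiniteDimensional 𝕜 K ∧ ∀ x ∈ Kᗮ, ‖T x‖ ≤ ε * ‖x‖ := by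
  have hne : {r : ℝ | ∃ (n : ℕ) (e : Fin n → E),
      Orthonormal 𝕜 e ∧ ∑ i, ‖T (e i)‖ ^ 2 = r}.Nonempty :=
    ⟨0, 0, Fin.elim0, .of_isEmpty _, by simp⟩
  obtain ⟨_, ⟨n, e, he, rfl⟩, hlt⟩ :=
    exists_lt_of_lt_csSup hne (sub_lt_self _ (pow_pos hε 2))
  refine ⟨Submodule.span 𝕜 (Set.range e), .span_of_finite 𝕜 (Set.finite_range e), fun x hx => ?_⟩
  rcases eq_or_ne x 0 with rfl | hx0
  · simp
  set u : E := ((‖x‖⁻¹ : ℝ) : 𝕜) • x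
  have hxu : x = (‖x‖ : 𝕜) • u := by simp [u, smul_smul, hx0]
  have hu : ‖u‖ = 1 := by simp [u, norm_smul, hx0]
  have hue (i : Fin n) : inner 𝕜 u (e i) = 0 := by
    have hxe := (Submodule.mem_orthogonal' _ x).1 hx (e i) (Submodule.subset_span ⟨i, rfl⟩)
    rw [inner_smul_left, hxe, mul_zero]
  have hcons := le_csSup h ⟨n + 1, _, orthonormal_vecCons_iff.2 ⟨hu, hue, he⟩, rfl⟩
  simp only [Fin.sum_univ_succ, Matrix.cons_val_zero, Matrix.cons_val_succ] at hcons
  have hTu : ‖T u‖ ≤ ε := le_of_sq_le_sq (by linarith) hε.le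
  calc ‖T x‖ = ‖x‖ * ‖T u‖ := by
        conv_lhs => rw [hxu]
        simp [norm_smul]
    _ ≤ ε * ‖x‖ := by rw [mul_comm]; gcongr

theorem isCompactOperator [CompleteSpace F] (h : IsHilbertSchmidt T) : IsCompactOperator T :=
  isCompactOperator_of_forall_exists_norm_le_on_orthogonal fun _ => h.exists_norm_le_on_orthogonal

end IsHilbertSchmidt

end NormedSpace

theorem IsHilbertSchmidt.summable_finrank_eigenspace_mul_norm_sq {T : E →L[𝕜] E}
    (h : IsHilbertSchmidt T) (hT : T.toLinearMap.IsSymmetric) :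
    Summable fun l : 𝕜 =>
      (Module.finrank 𝕜 (Module.End.eigenspace T.toLinearMap l) : ℝ) * ‖l‖ ^ 2 := by
  choose b hb using fun l : 𝕜 =>
    exists_orthonormal_fin_finrank (𝕜 := 𝕜) (E := Module.End.eigenspace T.toLinearMap l)
  have hTb (l : 𝕜) (i) : ‖T (b l i : E)‖ ^ 2 = ‖l‖ ^ 2 := by
    have heig : T (b l i : E) = l • (b l i : E) := Module.End.mem_eigenspace_iff.1 (b l i).2
    have hunit : ‖(b l i : E)‖ = 1 := (hb l).1 i
    rw [heig, norm_smul, hunit, mul_one]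
  have hsum := (h.summable_norm_sq
    (hT.orthogonalFamily_eigenspaces.orthonormal_sigma_orthonormal hb)).sigma
  simpa [hTb] using hsum

-- Bessel's inequality for `k x`, integrated over `x`.
theorem isHilbertSchmidt_of_ae_eq_inner {α : Type*} [MeasurableSpace α] {μ : Measure α}
    {T : E →L[𝕜] Lp 𝕜 2 μ} {k : α → E} {φ : α → ℝ} (hφ : Integrable φ μ)
    (hk : ∀ᵐ x ∂μ, ‖k x‖ ^ 2 ≤ φ x) (hT : ∀ f, T f =ᵐ[μ] fun x => inner 𝕜 (k x) f) :
    IsHilbertSchmidt T := by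
  refine ⟨∫ x, φ x ∂μ, ?_⟩
  rintro _ ⟨n, e, he, rfl⟩
  have hint (i : Fin n) : Integrable (fun x => ‖T (e i) x‖ ^ 2) μ :=
    (Lp.memLp (T (e i))).integrable_norm_pow two_ne_zero
  have hnorm (i : Fin n) : ‖T (e i)‖ ^ 2 = ∫ x, ‖T (e i) x‖ ^ 2 ∂μ := by
    have hinner := congrArg RCLike.re (L2.inner_def (𝕜 := 𝕜) (T (e i)) (T (e i)))
    rw [← integral_re (L2.integrable_inner _ _)] at hinner
    simpa only [inner_self_eq_norm_sq] using hinner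
  rw [Finset.sum_congr rfl fun i _ => hnorm i, ← integral_finsetSum _ fun i _ => hint i]
  refine integral_mono_ae (integrable_finsetSum _ fun i _ => hint i) hφ ?_
  filter_upwards [hk, ae_all_iff.2 fun i => hT (e i)] with x hkx hTx
  calc ∑ i, ‖T (e i) x‖ ^ 2 = ∑ i, ‖inner 𝕜 (e i) (k x)‖ ^ 2 := by
        simp only [hTx, norm_inner_symm]
    _ ≤ ‖k x‖ ^ 2 := he.sum_inner_products_le (k x)
    _ ≤ φ x := hkx

end HilbertSchmidt

section Spectral

open Module.End

variable {𝕜 E : Type*} [RCLike 𝕜] [NormedAddCommGroup E] [InnerProductSpace 𝕜 E]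

theorem eigenspace_smul_starProjection [DecidableEq 𝕜] (K : Submodule 𝕜 E)
    [K.HasOrthogonalProjection] (p : 𝕜) {l : 𝕜} (hl : l ≠ 0) :
    eigenspace (p • K.starProjection).toLinearMap l = if l = p then K else ⊥ := by
  ext v
  have hmem : v ∈ eigenspace (p • K.starProjection).toLinearMap l ↔ v ∈ K ∧ (p - l) • v = 0 := by
    simp only [mem_eigenspace_iff, ContinuousLinearMap.coe_coe, smul_apply]
    rw [sub_smul, sub_eq_zero]
    refine ⟨fun h => ?_, fun ⟨hv, h⟩ => by rwa [K.starProjection_eq_self_iff.2 hv]⟩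
    have hv : v ∈ K := by
      rw [← inv_smul_smul₀ hl v, ← h]
      exact K.smul_mem _ (K.smul_mem _ (K.starProjection_apply_mem v))
    rw [K.starProjection_eq_self_iff.2 hv] at h
    exact ⟨hv, h⟩
  rw [hmem]
  split_ifs with hlp
  · simp [hlp]
  · rw [smul_eq_zero_iff_right (sub_ne_zero.2 (Ne.symm hlp)), Submodule.mem_bot]
    exact ⟨And.right, fun hv => ⟨hv ▸ K.zero_mem, hv⟩⟩

theorem eq_smul_starProjection_eigenspace [CompleteSpace E] {T : E →L[𝕜] E}
    (hc : IsCompactOperator T) (hT : T.toLinearMap.IsSymmetric) {p : 𝕜}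
    (h : ∀ l ≠ 0, l ≠ p → eigenspace T.toLinearMap l = ⊥) :
    T = p • (eigenspace T.toLinearMap p).starProjection := by
  set P := (eigenspace T.toLinearMap p).starProjection with hP
  have hdense : Dense ((⨆ l, eigenspace T.toLinearMap l : Submodule 𝕜 E) : Set E) := by
    rw [Submodule.dense_iff_topologicalClosure_eq_top, Submodule.topologicalClosure_eq_top_iff]
    exact ContinuousLinearMap.orthogonalComplement_iSup_eigenspaces_eq_bot hc hT
  have hle : ⨆ l, eigenspace T.toLinearMap l ≤
      LinearMap.eqLocus T.toLinearMap (p • P).toLinearMap := by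
    refine iSup_le fun l v hv => ?_
    have hTv : T v = l • v := mem_eigenspace_iff.1 hv
    change T v = p • P v
    rw [hTv]
    rcases eq_or_ne l p with rfl | hlp
    · rw [hP, Submodule.starProjection_eq_self_iff.2 hv]
    rcases eq_or_ne l 0 with rfl | hl
    · have hortho : v ∈ (eigenspace T.toLinearMap p)ᗮ :=
        (hT.orthogonalFamily_eigenspaces.isOrtho hlp).le hv
      rw [hP, (Submodule.starProjection_apply_eq_zero_iff _).2 hortho, zero_smul, smul_zero]
    · rw [h l hl hlp, Submodule.mem_bot] at hv
      rw [hv, map_zero, smul_zero, smul_zero]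
  exact DFunLike.coe_injective
    (T.continuous.ext_on hdense (p • P).continuous fun v hv => hle hv)

theorem finrank_eigenspace_smul_starProjection_span_singleton [DecidableEq 𝕜] {e : E} (he : e ≠ 0)
    (p : 𝕜) {l : 𝕜} (hl : l ≠ 0) :
    Module.finrank 𝕜 (eigenspace (p • (𝕜 ∙ e).starProjection).toLinearMap l) =
      if l = p then 1 else 0 := by
  have heig := eigenspace_smul_starProjection (𝕜 ∙ e) p hl
  split_ifs at heig ⊢ with hlp
  · rw [heig, finrank_span_singleton he]
  · rw [heig, finrank_bot]

theorem mem_of_inner_starProjection_eq_one {K : Submodule 𝕜 E} [K.HasOrthogonalProjection] {e : E}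
    (he : ‖e‖ = 1) (h : inner 𝕜 e (K.starProjection e) = 1) : e ∈ K := by
  have hsq := K.re_inner_starProjection_eq_normSq e
  rw [K.inner_starProjection_left_eq_right, h, RCLike.one_re, eq_comm,
    pow_eq_one_iff_of_nonneg (norm_nonneg _) two_ne_zero] at hsq
  rw [Submodule.mem_iff_norm_starProjection, he]
  exact hsq

theorem eq_smul_starProjection_span_singleton_iff [DecidableEq 𝕜] [CompleteSpace E] {T : E →L[𝕜] E}
    (hc : IsCompactOperator T) (hT : T.toLinearMap.IsSymmetric) {e : E} (he : ‖e‖ = 1) {p : 𝕜} :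
    T = p • (𝕜 ∙ e).starProjection ↔ inner 𝕜 e (T e) = p ∧
      ∀ l ≠ 0, Module.finrank 𝕜 (eigenspace T.toLinearMap l) = if l = p then 1 else 0 := by
  have he0 : e ≠ 0 := norm_ne_zero_iff.1 (he ▸ one_ne_zero)
  constructor
  · rintro rfl
    refine ⟨?_, fun l => finrank_eigenspace_smul_starProjection_span_singleton he0 p⟩
    rw [smul_apply, Submodule.starProjection_eq_self_iff.2 (Submodule.mem_span_singleton_self e),
      inner_smul_right, inner_self_eq_norm_sq_to_K, he, RCLike.ofReal_one, one_pow, mul_one]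
  rintro ⟨hTe, hrank⟩
  have hTp := eq_smul_starProjection_eigenspace hc hT fun l hl hlp => by
    have := ContinuousLinearMap.finite_dimensional_eigenspace hc l hl
    exact Submodule.finrank_eq_zero.1 ((hrank l hl).trans (if_neg hlp))
  rcases eq_or_ne p 0 with rfl | hp
  · rw [hTp, zero_smul, zero_smul]
  have hmem : e ∈ eigenspace T.toLinearMap p := by
    refine mem_of_inner_starProjection_eq_one he ?_
    rwa [DFunLike.congr_fun hTp e, smul_apply, inner_smul_right, mul_eq_left₀ hp] at hTe
  have hspan := eq_span_singleton_of_mem_of_finrank_eq_one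
    ((hrank p hp).trans (if_pos rfl)) hmem he0
  simpa only [hspan] using hTp

end Spectral

section InfiniteProduct

open Filter Asymptotics Topology

variable {ι R : Type*} [NormedCommRing R] [NormOneClass R] [CompleteSpace R]

-- `‖aⁿ - 1‖ ≤ exp (n ‖a - 1‖) - 1`, which is comparable to `n ‖a - 1‖` when the latter is small.
theorem multipliable_pow_of_summable_mul_norm_sub_one {n : ι → ℕ} {a : ι → R}
    (h : Summable fun i => n i * ‖a i - 1‖) : Multipliable fun i => a i ^ n i := by
  have hpow (i : ι) : ‖a i ^ n i - 1‖ ≤ Real.exp (n i * ‖a i - 1‖) - 1 := by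
    simpa using Finset.norm_prod_one_add_sub_one_le (Finset.range (n i)) fun _ => a i - 1
  have hexp : (fun i => Real.exp (n i * ‖a i - 1‖) - 1) =O[cofinite] fun i => n i * ‖a i - 1‖ := by
    simpa [Function.comp_def] using
      (Real.hasDerivAt_exp 0).isBigO_sub.comp_tendsto h.tendsto_cofinite_zero
  have hsum : Summable fun i => ‖a i ^ n i - 1‖ :=
    .of_nonneg_of_le (fun _ => norm_nonneg _) hpow (summable_of_isBigO h hexp)
  simpa using multipliable_one_add_of_summable hsum

theorem multipliable_comp_pow_of_isBigO {E : Type*} [NormedAddCommGroup E] {f : E → R} {k : ℕ}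
    (hf : (fun w => f w - 1) =O[𝓝 0] fun w => ‖w‖ ^ k) {n : ι → ℕ} {a : ι → E}
    (h : Summable fun i => n i * ‖a i‖ ^ k) (hk : k ≠ 0) :
    Multipliable fun i => f (a i) ^ n i := by
  -- Where `n i = 0` the value `a i` is irrelevant; setting it to `0` makes the family tend to `0`.
  let b (i : ι) : E := if n i = 0 then 0 else a i
  have hb : Tendsto b cofinite (𝓝 0) := by
    have hle (i : ι) : ‖b i‖ ^ k ≤ n i * ‖a i‖ ^ k := by
      by_cases hi : n i = 0
      · simp [b, hi, hk]
      · simpa [b, hi] using le_mul_of_one_le_left (by positivity : 0 ≤ ‖a i‖ ^ k)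
          (Nat.one_le_cast.2 (Nat.one_le_iff_ne_zero.2 hi))
    refine NormedAddGroup.tendsto_nhds_zero.2 fun ε hε => ?_
    filter_upwards [h.tendsto_cofinite_zero.eventually_lt_const (pow_pos hε k)] with i hi
    exact lt_of_pow_lt_pow_left₀ k hε.le ((hle i).trans_lt hi)
  have hO : (fun i => n i * ‖f (a i) - 1‖) =O[cofinite] fun i => n i * ‖a i‖ ^ k := by
    refine ((isBigO_refl (fun i => (n i : ℝ)) cofinite).mul
      (hf.norm_left.comp_tendsto hb)).congr (fun i => ?_) (fun i => ?_) <;>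
    · by_cases hi : n i = 0 <;> simp [b, hi]
  exact multipliable_pow_of_summable_mul_norm_sub_one (summable_of_isBigO h hO)

/-- Weierstrass' elementary factor of genus two at `-w`, normalized so that its only zero is
`w = -1`; the regularized determinant `det₃ g z` is the product of its values at `z * l` over the
eigenvalues `l`. -/
noncomputable def weierstrassFactor (w : ℂ) : ℂ := (1 + w) * Complex.exp (-w + w ^ 2 / 2)

theorem weierstrassFactor_zero : weierstrassFactor 0 = 1 := by
  simp [weierstrassFactor]

theorem weierstrassFactor_eq_zero_iff {w : ℂ} : weierstrassFactor w = 0 ↔ w = -1 := by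
  rw [weierstrassFactor, mul_eq_zero, or_iff_left (Complex.exp_ne_zero _),
    add_eq_zero_iff_neg_eq, eq_comm]

theorem weierstrassFactor_sub_one_isBigO :
    (fun w => weierstrassFactor w - 1) =O[𝓝 0] fun w => ‖w‖ ^ 2 := by
  let u (w : ℂ) : ℂ := -w + w ^ 2 / 2
  have mul_isBigO {c f g : ℂ → ℂ} (hc : Continuous c) (hfg : f =O[𝓝 0] g) :
      (fun w => c w * f w) =O[𝓝 0] g := by
    simpa using (hc.continuousAt.isBigO_one ℂ).mul hfg
  have hu : u =O[𝓝 0] fun w => w :=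
    (mul_isBigO (c := fun w => w / 2 - 1) (by fun_prop) (isBigO_refl _ _)).congr_left
      fun w => by ring
  have hu0 : Tendsto u (𝓝 0) (𝓝 0) := hu.trans_tendsto tendsto_id
  have hexp : (fun w => Complex.exp (u w) - (1 + u w)) =O[𝓝 0] fun w => w ^ 2 := by
    simpa [Finset.sum_range_succ, Function.comp_def] using
      ((Complex.exp_sub_sum_range_isBigO_pow 2).comp_tendsto hu0).trans (hu.pow 2)
  have hsplit (w : ℂ) : (1 + w) * (Complex.exp (u w) - (1 + u w)) + (w - 1) / 2 * w ^ 2 =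
      weierstrassFactor w - 1 := by
    simp only [weierstrassFactor, u]
    ring
  simpa only [norm_pow] using ((mul_isBigO (c := fun w => 1 + w) (by fun_prop) hexp).add
    (mul_isBigO (c := fun w => (w - 1) / 2) (by fun_prop) (isBigO_refl _ _))).norm_right.congr_left
      hsplit

theorem weierstrassFactor_one_pow_injective :
    Function.Injective fun n : ℕ => weierstrassFactor 1 ^ n := by
  have hval : weierstrassFactor 1 = ((2 * Real.exp (-1 / 2) : ℝ) : ℂ) := by
    push_cast [weierstrassFactor]
    norm_num
  have hlt : 1 < 2 * Real.exp (-1 / 2) := by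
    linarith [Real.add_one_lt_exp (show (-1 / 2 : ℝ) ≠ 0 by norm_num)]
  intro m n hmn
  simp only [hval] at hmn
  exact pow_right_injective₀ (zero_lt_one.trans hlt) hlt.ne' (by exact_mod_cast hmn)

end InfiniteProduct

theorem ae_eq_zero_of_forall_setIntegral_prod_eq_zero {α β E : Type*} [MeasurableSpace α]
    [MeasurableSpace β] [NormedAddCommGroup E] [NormedSpace ℝ E] [CompleteSpace E]
    {μ : Measure (α × β)} {w : α × β → E} (hw : Integrable w μ)
    (h : ∀ S T, MeasurableSet S → MeasurableSet T → ∫ z in S ×ˢ T, w z ∂μ = 0) :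
    w =ᵐ[μ] 0 := by
  suffices ∀ s, MeasurableSet s → ∫ z in s, w z ∂μ = 0 from
    hw.ae_eq_zero_of_forall_setIntegral_eq_zero fun s hs _ => this s hs
  intro s hs
  induction s, hs
    using MeasurableSpace.induction_on_inter generateFrom_prod.symm isPiSystem_prod with
  | empty => exact setIntegral_empty
  | basic t ht =>
    obtain ⟨S, hS, T, hT, rfl⟩ := ht
    exact h S T hS hT
  | compl t ht ih =>
    have htot : ∫ z, w z ∂μ = 0 := by simpa using h _ _ .univ .univ
    rw [setIntegral_compl ht hw, htot, ih, sub_zero]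
  | iUnion f hd hf ih => simp only [integral_iUnion hf hd hw.integrableOn, ih, tsum_zero]

theorem cutNorm_eq_zero_iff {w : unitInterval × unitInterval → ℝ} (hw : Integrable w) :
    cutNorm w = 0 ↔ w =ᵐ[volume] 0 := by
  refine ⟨fun h => ae_eq_zero_of_forall_setIntegral_prod_eq_zero hw fun S T hS hT =>
    abs_nonpos_iff.1 ((le_cutNorm hw hS hT).trans h.le), fun h => ?_⟩
  have hrect (S T : Set unitInterval) : ∫ z in S ×ˢ T, w z = 0 := by
    rw [integral_congr_ae (ae_restrict_of_ae h), Pi.zero_def, integral_zero]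
  simp [cutNorm, hrect]

theorem cutNorm_relabel (σ : LebesgueIso) {w : unitInterval × unitInterval → ℝ}
    (hw : Integrable w) : cutNorm (relabel σ w) = cutNorm w := by
  refine (cutNorm_relabel_le σ hw).antisymm ?_
  have hinv : relabel σ.inv (relabel σ w) = w := by
    ext z
    simp [relabel, LebesgueIso.inv]
  simpa only [hinv] using cutNorm_relabel_le σ.inv (integrable_relabel σ hw)

-- Relabelling does not move a constant, so all the cut norms in the infimum agree.
theorem GraphFunction.cutDist_const_eq_zero_iff {g : GraphFunction} {p : ℝ}
    {hp : p ∈ Set.Icc (0 : ℝ) 1} :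
    cutDist g (const p hp) = 0 ↔ g.toFun =ᵐ[volume] (const p hp).toFun := by
  have hw := g.integrable.sub (const p hp).integrable
  have hσ (σ : LebesgueIso) : cutNorm (fun z => relabel σ g.toFun z - (const p hp).toFun z) =
      cutNorm (g.toFun - (const p hp).toFun) := cutNorm_relabel σ hw
  rw [cutDist, iInf_congr hσ, ciInf_const, cutNorm_eq_zero_iff hw, sub_ae_eq_zero]

namespace GraphFunction

theorem integralOperator_coeFn (g : GraphFunction) (f : Lp ℝ 2 (volume : Measure unitInterval)) :
    integralOperator g f =ᵐ[volume] kernelIntegral g f :=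
  (memLp_kernelIntegral g f).coeFn_toLp

theorem norm_toFun_le_one (g : GraphFunction) (z : unitInterval × unitInterval) :
    ‖g.toFun z‖ ≤ 1 := by
  rw [Real.norm_of_nonneg (g.mem_Icc' z).1]
  exact (g.mem_Icc' z).2

theorem memLp_slice (g : GraphFunction) (x : unitInterval) :
    MemLp (fun y => g.toFun (x, y)) 2 volume :=
  MemLp.of_bound (g.measurable'.comp measurable_prodMk_left).aestronglyMeasurable 1
    (.of_forall fun _ => g.norm_toFun_le_one _)

/-- The slice `g(x, ·)` as an element of `L²([0,1])`, for every `x` and not only for almost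
every `x`: this represents `f ↦ (T_g f)(x)` as an inner product. -/
noncomputable def sliceL2 (g : GraphFunction) (x : unitInterval) :
    Lp ℝ 2 (volume : Measure unitInterval) :=
  (g.memLp_slice x).toLp

theorem sliceL2_coeFn (g : GraphFunction) (x : unitInterval) :
    g.sliceL2 x =ᵐ[volume] fun y => g.toFun (x, y) :=
  (g.memLp_slice x).coeFn_toLp

theorem norm_sliceL2_le_one (g : GraphFunction) (x : unitInterval) : ‖g.sliceL2 x‖ ≤ 1 := by
  have hle := Lp.norm_le_of_ae_bound (f := g.sliceL2 x) zero_le_one (by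
    filter_upwards [g.sliceL2_coeFn x] with y hy
    exact hy ▸ g.norm_toFun_le_one _)
  simpa [measureUnivNNReal] using hle

theorem kernelIntegral_eq_inner (g : GraphFunction) (f : Lp ℝ 2 (volume : Measure unitInterval))
    (x : unitInterval) : kernelIntegral g f x = inner ℝ (g.sliceL2 x) f := by
  rw [L2.inner_def, kernelIntegral]
  refine integral_congr_ae ?_
  filter_upwards [g.sliceL2_coeFn x] with y hy
  rw [hy, real_inner_eq_re_inner, RCLike.inner_apply]
  simp [mul_comm]

theorem isHilbertSchmidt_integralOperator (g : GraphFunction) :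
    IsHilbertSchmidt (integralOperator g) :=
  isHilbertSchmidt_of_ae_eq_inner (integrable_const 1)
    (.of_forall fun x => pow_le_one₀ (norm_nonneg _) (g.norm_sliceL2_le_one x))
    fun f => (g.integralOperator_coeFn f).trans (.of_forall (g.kernelIntegral_eq_inner f))

theorem isCompactOperator_integralOperator (g : GraphFunction) :
    IsCompactOperator (integralOperator g) :=
  g.isHilbertSchmidt_integralOperator.isCompactOperator

theorem inner_integralOperator (g : GraphFunction)
    (f h : Lp ℝ 2 (volume : Measure unitInterval)) :
    inner ℝ h (integralOperator g f) =
      ∫ z : unitInterval × unitInterval, g.toFun z * (h z.1 * f z.2) := by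
  have hint : Integrable fun z : unitInterval × unitInterval => g.toFun z * (h z.1 * f z.2) :=
    ((integrable_of_Lp h).mul_prod (integrable_of_Lp f)).bdd_mul (c := 1)
      g.measurable'.aestronglyMeasurable (.of_forall g.norm_toFun_le_one)
  rw [L2.inner_def, Measure.volume_eq_prod, integral_prod _ hint]
  refine integral_congr_ae ?_
  filter_upwards [g.integralOperator_coeFn f] with x hx
  rw [hx, kernelIntegral, real_inner_eq_re_inner, RCLike.inner_apply, conj_trivial]
  rw [← integral_mul_const]
  exact integral_congr_ae (.of_forall fun y => by ring)

theorem isSymmetric_integralOperator (g : GraphFunction) :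
    (integralOperator g).toLinearMap.IsSymmetric := by
  intro f h
  change inner ℝ (integralOperator g f) h = inner ℝ f (integralOperator g h)
  rw [real_inner_comm, inner_integralOperator, inner_integralOperator, Measure.volume_eq_prod,
    ← integral_prod_swap]
  refine integral_congr_ae ?_
  filter_upwards [g.symm'] with z hz
  rw [Prod.swap, ← hz, mul_comm (h z.2)]

theorem inner_indicatorConstLp_integralOperator (g : GraphFunction) {S T : Set unitInterval}
    (hS : MeasurableSet S) (hT : MeasurableSet T) :
    inner ℝ (indicatorConstLp 2 hS (measure_ne_top volume S) (1 : ℝ))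
      (integralOperator g (indicatorConstLp 2 hT (measure_ne_top volume T) (1 : ℝ))) =
      ∫ z in S ×ˢ T, g.toFun z := by
  rw [L2.inner_indicatorConstLp_one, Measure.volume_eq_prod,
    setIntegral_prod _ g.integrable.integrableOn]
  refine setIntegral_congr_ae hS ?_
  filter_upwards [g.integralOperator_coeFn (indicatorConstLp 2 hT (measure_ne_top _ T) 1)]
    with x hx _
  rw [hx, kernelIntegral_eq_inner, real_inner_comm, L2.inner_indicatorConstLp_one]
  exact integral_congr_ae (ae_restrict_of_ae (g.sliceL2_coeFn x))

theorem integralOperator_eq_iff {g h : GraphFunction} :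
    integralOperator g = integralOperator h ↔ g.toFun =ᵐ[volume] h.toFun := by
  refine ⟨fun hgh => ?_, fun hgh => ?_⟩
  · refine (sub_ae_eq_zero _ _).1 <| ae_eq_zero_of_forall_setIntegral_prod_eq_zero
      (g.integrable.sub h.integrable) fun S T hS hT => ?_
    simp only [Pi.sub_apply]
    rw [integral_sub g.integrable.integrableOn h.integrable.integrableOn,
      ← g.inner_indicatorConstLp_integralOperator hS hT, hgh,
      h.inner_indicatorConstLp_integralOperator hS hT, sub_self]
  · refine ContinuousLinearMap.ext fun f => Lp.ext ?_
    filter_upwards [Measure.ae_ae_of_ae_prod hgh, g.integralOperator_coeFn f,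
      h.integralOperator_coeFn f] with x hx hg hh
    rw [hg, hh]
    refine integral_congr_ae ?_
    filter_upwards [hx] with y hy
    rw [hy]

/-- The constant function `1` in `L²([0,1])`. -/
noncomputable def oneL2 : Lp ℝ 2 (volume : Measure unitInterval) := Lp.const 2 volume 1

theorem oneL2_coeFn : oneL2 =ᵐ[volume] Function.const unitInterval 1 :=
  Lp.coeFn_const 2 volume 1

theorem norm_oneL2 : ‖oneL2‖ = 1 := by
  simp [oneL2, Lp.norm_const]

theorem oneL2_eq_indicatorConstLp_univ :
    oneL2 = indicatorConstLp 2 .univ (measure_ne_top volume Set.univ) (1 : ℝ) :=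
  (indicatorConstLp_univ 2 volume 1).symm

theorem inner_oneL2_integralOperator_oneL2 (g : GraphFunction) :
    inner ℝ oneL2 (integralOperator g oneL2) = edgeDensity g := by
  rw [oneL2_eq_indicatorConstLp_univ, inner_indicatorConstLp_integralOperator,
    Set.univ_prod_univ, setIntegral_univ, edgeDensity]

theorem integralOperator_const {p : ℝ} (hp : p ∈ Set.Icc (0 : ℝ) 1) :
    integralOperator (const p hp) = p • (ℝ ∙ oneL2).starProjection := by
  refine ContinuousLinearMap.ext fun f => Lp.ext ?_
  rw [smul_apply, Submodule.starProjection_unit_singleton ℝ norm_oneL2, smul_smul]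
  filter_upwards [(const p hp).integralOperator_coeFn f, oneL2_coeFn,
    Lp.coeFn_smul (p * inner ℝ oneL2 f) oneL2] with x hTf hone hsmul
  rw [hTf, hsmul, Pi.smul_apply, hone, Function.const_apply, smul_eq_mul, mul_one,
    oneL2_eq_indicatorConstLp_univ, L2.inner_indicatorConstLp_one, setIntegral_univ]
  exact integral_const_mul p f

theorem detFactor_eq (g : GraphFunction) (z : ℂ) (l : ℝ) :
    detFactor g z l = weierstrassFactor (z * l) ^ multiplicity g l := by
  rw [detFactor, weierstrassFactor, mul_pow z]

theorem multipliable_detFactor (g : GraphFunction) (z : ℂ) :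
    Multipliable fun l : ℝ => detFactor g z l := by
  simp only [detFactor_eq]
  refine multipliable_comp_pow_of_isBigO weierstrassFactor_sub_one_isBigO ?_ two_ne_zero
  have hsum := (g.isHilbertSchmidt_integralOperator.summable_finrank_eigenspace_mul_norm_sq
    g.isSymmetric_integralOperator).mul_right (‖z‖ ^ 2)
  refine hsum.congr fun l => ?_
  rw [norm_mul, Complex.norm_real, multiplicity]
  ring

theorem det₃_neg_inv_eq_zero {g : GraphFunction} {l : ℝ} (hl : l ≠ 0)
    (hm : multiplicity g l ≠ 0) : det₃ g (-(l : ℂ)⁻¹) = 0 := by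
  refine tprod_of_exists_eq_zero ⟨l, ?_⟩
  have hz : -(l : ℂ)⁻¹ * l = -1 := by
    rw [neg_mul, inv_mul_cancel₀ (Complex.ofReal_ne_zero.2 hl)]
  rw [detFactor_eq, hz, weierstrassFactor_eq_zero_iff.2 rfl, zero_pow hm]

theorem det₃_eq_weierstrassFactor_pow {g : GraphFunction} {p : ℝ}
    (h : ∀ l ≠ 0, l ≠ p → multiplicity g l = 0) (z : ℂ) :
    det₃ g z = weierstrassFactor (p * z) ^ multiplicity g p := by
  rw [det₃, tprod_eq_mulSingle p fun l hlp => ?_, detFactor_eq, mul_comm z]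
  rcases eq_or_ne l 0 with rfl | hl
  · rw [detFactor_eq, Complex.ofReal_zero, mul_zero, weierstrassFactor_zero, one_pow]
  · rw [detFactor_eq, h l hl hlp, pow_zero]

theorem det₃_eq_weierstrassFactor_iff {g : GraphFunction} {p : ℝ} :
    (∀ z, det₃ g z = weierstrassFactor (p * z)) ↔
      ∀ l ≠ 0, multiplicity g l = if l = p then 1 else 0 := by
  constructor
  · intro hdet
    have hother (l : ℝ) (hl : l ≠ 0) (hlp : l ≠ p) : multiplicity g l = 0 := by
      by_contra hm
      have hzero := det₃_neg_inv_eq_zero hl hm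
      rw [hdet, weierstrassFactor_eq_zero_iff, mul_neg, neg_inj, ← div_eq_mul_inv,
        div_eq_one_iff_eq (Complex.ofReal_ne_zero.2 hl)] at hzero
      exact hlp (Complex.ofReal_injective hzero).symm
    intro l hl
    split_ifs with hlp
    · subst hlp
      have hval := hdet (l : ℂ)⁻¹
      rw [det₃_eq_weierstrassFactor_pow hother, mul_inv_cancel₀ (Complex.ofReal_ne_zero.2 hl)]
        at hval
      exact weierstrassFactor_one_pow_injective (by simpa using hval)
    · exact hother l hl hlp
  · intro hmult z
    rw [det₃_eq_weierstrassFactor_pow fun l hl hlp => (hmult l hl).trans (if_neg hlp)]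
    rcases eq_or_ne p 0 with rfl | hp
    · rw [Complex.ofReal_zero, zero_mul, weierstrassFactor_zero, one_pow]
    · rw [hmult p hp, if_pos rfl, pow_one]

theorem integralOperator_eq_smul_starProjection_iff {g : GraphFunction} {p : ℝ} :
    integralOperator g = p • (ℝ ∙ oneL2).starProjection ↔
      edgeDensity g = p ∧ ∀ l ≠ 0, multiplicity g l = if l = p then 1 else 0 := by
  rw [eq_smul_starProjection_span_singleton_iff g.isCompactOperator_integralOperator
    g.isSymmetric_integralOperator norm_oneL2, inner_oneL2_integralOperator_oneL2]
  rfl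

end GraphFunction

/-- For every representative `g` of the graphon `γ`, the product defining `det₃` converges, and
`γ = γ_p` iff `γ` has edge density `p` and the stated `3`-modified Fredholm determinant, computed
from `g`. -/
theorem mainTheorem10 (γ : Graphon) (g : GraphFunction) (hg : Graphon.mk g = γ)
    (p : ℝ) (hp : p ∈ Set.Icc (0 : ℝ) 1) :
    (∀ z : ℂ, Multipliable (fun l : ℝ => GraphFunction.detFactor g z l)) ∧
    (γ = Graphon.const p hp ↔
      γ.edgeDensity = p ∧
        ∀ z : ℂ, GraphFunction.det₃ g z =
          (1 + (p : ℂ) * z) * Complex.exp (-((p : ℂ) * z) + (p : ℂ) ^ 2 * z ^ 2 / 2)) := by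
  subst hg
  refine ⟨g.multipliable_detFactor, ?_⟩
  have hdet (z : ℂ) : (1 + (p : ℂ) * z) * Complex.exp (-((p : ℂ) * z) + (p : ℂ) ^ 2 * z ^ 2 / 2) =
      weierstrassFactor (p * z) := by
    rw [weierstrassFactor, mul_pow]
  calc Graphon.mk g = Graphon.const p hp
      ↔ GraphFunction.cutDist g (.const p hp) = 0 := Quotient.eq
    _ ↔ g.toFun =ᵐ[volume] (GraphFunction.const p hp).toFun :=
        GraphFunction.cutDist_const_eq_zero_iff
    _ ↔ g.integralOperator = (GraphFunction.const p hp).integralOperator :=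
        GraphFunction.integralOperator_eq_iff.symm
    _ ↔ g.edgeDensity = p ∧ ∀ l ≠ 0, g.multiplicity l = if l = p then 1 else 0 := by
        rw [GraphFunction.integralOperator_const,
          GraphFunction.integralOperator_eq_smul_starProjection_iff]
    _ ↔ g.edgeDensity = p ∧ ∀ z, g.det₃ z = weierstrassFactor (p * z) := by
        rw [GraphFunction.det₃_eq_weierstrassFactor_iff]
    _ ↔ _ := by
        simp only [hdet]
        rfl
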